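/- Let $R$ be a commutative noetherian ring. For an $R$-module $X$, the small support $\operatorname{supp} X$ is the set of prime ideals $\mathfrak p$ of $R$ such that $X\otimes^{\mathbf L}_R\kappa(\mathfrak p)\not\cong 0$ in the derived category, where $\kappa(\mathfrak p)=R_{\mathfrak p}/\mathfrak pR_{\mathfrak p}$; equivalently, $\operatorname{Tor}^R_i(X,\kappa(\mathfrak p))\neq0$ for some $i\ge0$. For an ideal $I$ of $R$, let $\mathrm D(I)$ be the set of prime ideals of $R$ not containing $I$, and let $\operatorname{supp}^{-1}\mathrm D(I)$ be the full subcategory of the category $\operatorname{Mod}R$ of all $R$-modules consisting of the modules $X$ with $\operatorname{supp}X\subseteq\mathrm D(I)$. For an integer $n\ge0$, a full subcategory $\mathcal X$ of $\operatorname{Mod}R$ is called $n$-wide if it is closed under extensions and, for every exact sequence $0\to K\to X^0\to\cdots\to X^n\to C\to0$ in $\operatorname{Mod}R$ with all $X^i\in\mathcal X$, both $K$ and $C$ belong to $\mathcal X$. For a finitely generated $R$-module $M$ with $IM\ne M$, let $\operatorname{grade}(I,M)$ be the supremum of the lengths of the $M$-regular sequences of elements of $I$. Let $I$ be an ideal of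 $R$, let $n\ge0$ be an integer, and let $M$ be a finitely generated $R$-module with $IM\ne M$. If $\operatorname{supp}^{-1}\mathrm D(I)$ is $n$-wide, then $\operatorname{grade}(I,M)\le n$. -/

import Mathlib

open CategoryTheory

universe u v

namespace NWide

section Abelian

variable {C : Type u} [Category.{v} C] [Abelian C]

/-- The sequence `0 ⟶ F₀ ⟶ F₁ ⟶ ⋯ ⟶ Fₙ₊₁ ⟶ Fₙ₊₂ ⟶ 0` is exact. -/
structure IsExactFromZeroToZero {n : ℕ} (F : ComposableArrows C (n + 2)) : Prop where
  exact : F.Exact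
  mono : Mono (F.map' 0 1)
  epi : Epi (F.map' (n + 1) (n + 2))

/-- A full subcategory is closed under `n`-kernels if for every exact sequence
`0 ⟶ M ⟶ X⁰ ⟶ ⋯ ⟶ Xⁿ ⟶ N ⟶ 0` with all `Xⁱ` in it, the object `M` is in it.
Here `M = F.obj' 0`, `Xⁱ = F.obj' (i + 1)` and `N = F.obj' (n + 2)`. -/
def IsClosedUnderNKernels (P : ObjectProperty C) (n : ℕ) : Prop :=
  ∀ F : ComposableArrows C (n + 2), IsExactFromZeroToZero F →
    (∀ (i : ℕ) (_ : i ≤ n), P (F.obj' (i + 1))) → P (F.obj' 0)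

/-- A full subcategory is closed under `n`-cokernels if for every exact sequence
`0 ⟶ M ⟶ X⁰ ⟶ ⋯ ⟶ Xⁿ ⟶ N ⟶ 0` with all `Xⁱ` in it, the object `N` is in it. -/
def IsClosedUnderNCokernels (P : ObjectProperty C) (n : ℕ) : Prop :=
  ∀ F : ComposableArrows C (n + 2), IsExactFromZeroToZero F →
    (∀ (i : ℕ) (_ : i ≤ n), P (F.obj' (i + 1))) → P (F.obj' (n + 2))

/-- A full subcategory is `n`-wide if it is closed under extensions, `n`-kernels and
`n`-cokernels. -/
structure IsNWide (P : ObjectProperty C) (n : ℕ) : Prop where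
  extensions : P.IsClosedUnderExtensions
  kernels : IsClosedUnderNKernels P n
  cokernels : IsClosedUnderNCokernels P n

end Abelian

section Modules

variable {R : Type u} [CommRing R]

/-- The small support of a module `X`: the primes `p` with `X ⊗ᴸ κ(p) ≇ 0`, that is, such that
`Tor i (X, κ(p)) = Hᵢ (X ⊗ᴸ κ(p))` is nonzero for some `i`, where `κ(p) = R_p / p R_p`. -/
def smallSupport (X : ModuleCat.{u} R) : Set (PrimeSpectrum R) :=
  {p | ∃ i : ℕ, ¬ Limits.IsZero
    (((Tor (ModuleCat.{u} R) i).obj X).obj (ModuleCat.of R p.asIdeal.ResidueField))}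

/-- The full subcategory `supp⁻¹(Φ)` of the modules `X` with `supp X ⊆ Φ`. -/
def suppInv (Φ : Set (PrimeSpectrum R)) : ObjectProperty (ModuleCat.{u} R) :=
  fun X => smallSupport X ⊆ Φ

/-- `D(I)`: the set of the primes that do not contain `I`. -/
def primesNotContaining (I : Ideal R) : Set (PrimeSpectrum R) :=
  {p | ¬ I ≤ p.asIdeal}

/-- `grade(I, M)`: the supremum of the lengths of the `M`-regular sequences of elements of `I`
(the standard notion for finitely generated `M` with `I M ≠ M`). -/
noncomputable def idealGrade (I : Ideal R) (M : Type v) [AddCommGroup M] [Module R M] : ℕ∞ :=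
  ⨆ rs : {rs : List R // (∀ r ∈ rs, r ∈ I) ∧ RingTheory.Sequence.IsRegular M rs},
    (rs.1.length : ℕ∞)

end Modules

end NWide

namespace NWide

/-! ### Splicing exact sequences. -/

section Splicing

variable {C : Type u} [Category.{v} C] [Abelian C]

/-! Suppose `x₀, …, xₙ` in `I` is regular on `M`. Then `M` embeds in `M_{x₀}`, and `x₁, …, xₙ` stays
weakly regular on `M_{x₀} / M` (`AwayQuotient.isWeaklyRegular`). Iterating and splicing gives `0 ⟶ M
⟶ X⁰ ⟶ ⋯ ⟶ Xⁿ ⟶ N ⟶ 0` with each `Xⁱ` a localization at `xᵢ`. For `p ⊇ I`, `xᵢ` is invertible on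
`Xⁱ` and zero on `κ(p)`, so all Tor vanish and `supp Xⁱ ⊆ D(I)`. Closure under `n`-kernels forces
`supp M ⊆ D(I)`. But `M / IM ≠ 0` gives a prime of `Supp M` containing `I`, and it lies in `supp M`
by Nakayama. -/

lemma IsExactFromZeroToZero.mk₂ {A B D : C} (f : A ⟶ B) (g : B ⟶ D) (w : f ≫ g = 0)
    (h : (ShortComplex.mk f g w).ShortExact) :
    IsExactFromZeroToZero (n := 0) (ComposableArrows.mk₂ f g) where
  exact := h.exact.exact_toComposableArrows
  mono := h.mono_f
  epi := h.epi_g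

/-- Splicing a short exact sequence on the left of an exact sequence `0 ⟶ F₀ ⟶ ⋯ ⟶ 0`. -/
lemma IsExactFromZeroToZero.splice {n : ℕ} {F : ComposableArrows C (n + 2)}
    (hF : IsExactFromZeroToZero F) {A B : C} (f : A ⟶ B) (g : B ⟶ F.obj' 0) (w : f ≫ g = 0)
    (h : (ShortComplex.mk f g w).ShortExact) :
    IsExactFromZeroToZero (n := n + 1)
      ((F.δ₀.precomp (g ≫ F.map' 0 1)).precomp f) := by
  have := hF.mono
  have hw : (g ≫ F.map' 0 1) ≫ F.map' 1 2 = 0 := by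
    rw [Category.assoc, hF.exact.zero 0, Limits.comp_zero]
  have hw' : f ≫ g ≫ F.map' 0 1 = 0 := by rw [← Category.assoc, w, Limits.zero_comp]
  have := h.epi_g
  have h₀ : (F.δ₀.precomp (g ≫ F.map' 0 1)).Exact := by
    refine ComposableArrows.exact_of_δ₀ ?_ hF.exact.δ₀
    let φ : ShortComplex.mk _ _ hw ⟶ ShortComplex.mk _ _ (hF.exact.zero 0) :=
      { τ₁ := g, τ₂ := 𝟙 _, τ₃ := 𝟙 _ }
    have : Epi φ.τ₁ := h.epi_g
    have : IsIso φ.τ₂ := inferInstanceAs (IsIso (𝟙 _))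
    have : Mono φ.τ₃ := inferInstanceAs (Mono (𝟙 _))
    exact ((ShortComplex.exact_iff_of_epi_of_isIso_of_mono φ).2
      (hF.exact.exact 0)).exact_toComposableArrows
  refine ⟨ComposableArrows.exact_of_δ₀ ?_ h₀, h.mono_f, hF.epi⟩
  let φ : ShortComplex.mk _ _ w ⟶ ShortComplex.mk _ _ hw' :=
    { τ₁ := 𝟙 _, τ₂ := 𝟙 _, τ₃ := F.map' 0 1 }
  have : Epi φ.τ₁ := inferInstanceAs (Epi (𝟙 _))
  have : IsIso φ.τ₂ := inferInstanceAs (IsIso (𝟙 _))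
  have : Mono φ.τ₃ := hF.mono
  exact ((ShortComplex.exact_iff_of_epi_of_isIso_of_mono φ).1 h.exact).exact_toComposableArrows

end Splicing

/-! ### Regular sequences and the quotient `M_x / M`. -/

section Regular

open RingTheory.Sequence
open scoped Pointwise

variable {R : Type u} [CommRing R]

/-- Every nonzero element of `N` has an `x`-power multiple that is nonzero and killed by `x`, hence
lies in `A`; if `r` kills the element, it kills that multiple too. -/
lemma isSMulRegular_of_ker_smul {A N : Type*} [AddCommGroup A] [Module R A] [AddCommGroup N]
    [Module R N] {x r : R} (f : A →ₗ[R] N)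
    (hf : Function.Injective f) (hker : ∀ n : N, x • n = 0 → n ∈ LinearMap.range f)
    (htors : ∀ n : N, ∃ k : ℕ, x ^ k • n = 0) (h : IsSMulRegular A r) : IsSMulRegular N r := by
  rw [isSMulRegular_iff_right_eq_zero_of_smul] at h ⊢
  have key : ∀ (k : ℕ) (n : N), x ^ k • n = 0 → r • n = 0 → n = 0 := by
    intro k
    induction k with
    | zero => intro n hn _; simpa using hn
    | succ k ih =>
      intro n hn hr
      have hx : x • n = 0 := by
        refine ih _ ?_ (by rw [smul_comm, hr, smul_zero])
        rwa [← mul_smul, ← pow_succ]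
      obtain ⟨a, rfl⟩ := hker n hx
      rw [← map_smul] at hr
      rw [h a (hf (hr.trans (map_zero f).symm)), map_zero]
  intro n hr
  obtain ⟨k, hk⟩ := htors n
  exact key k n hk hr

/-- If `A` is the kernel of `x` on an `x`-divisible and `x`-power torsion module `N`, then weakly
regular sequences on `A` are weakly regular on `N`. -/
lemma isWeaklyRegular_of_ker_smul {x : R} (rs : List R) :
    ∀ {A N : Type u} [AddCommGroup A] [Module R A] [AddCommGroup N] [Module R N]
      (f : A →ₗ[R] N), Function.Injective f → Function.Exact f (LinearMap.lsmul R N x) →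
      (∀ n : N, ∃ n', x • n' = n) → (∀ n : N, ∃ k : ℕ, x ^ k • n = 0) →
      IsWeaklyRegular A rs → IsWeaklyRegular N rs := by
  induction rs with
  | nil => intros; exact .nil R _
  | cons r rs ih =>
    intro A N _ _ _ _ f hf hex hdiv htors h
    rw [isWeaklyRegular_cons_iff] at h ⊢
    have hr := isSMulRegular_of_ker_smul f hf (fun n hn => (hex n).1 hn) htors h.1
    -- As `r` is regular on `N`, reducing `0 ⟶ A ⟶ N ⟶ N ⟶ 0` (second map `x`) modulo `r` keeps it
    -- exact, so the induction hypothesis applies to `A / rA` and `N / rN`.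
    refine ⟨hr, ih (QuotSMulTop.map r f) ?_ ?_ ?_ ?_ h.2⟩
    · rw [← LinearMap.ker_eq_bot, LinearMap.ker_eq_bot']
      intro a ha
      obtain ⟨a, rfl⟩ := Submodule.Quotient.mk_surjective _ a
      rw [QuotSMulTop.map_apply_mk, Submodule.Quotient.mk_eq_zero,
        Submodule.mem_smul_pointwise_iff_exists] at ha
      obtain ⟨n, -, hn⟩ := ha
      have hxn : x • n = 0 := by
        refine isSMulRegular_iff_right_eq_zero_of_smul.1 hr _ ?_
        rw [smul_comm, hn]
        exact (hex _).2 ⟨a, rfl⟩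
      obtain ⟨b, rfl⟩ := (hex n).1 hxn
      rw [← map_smul] at hn
      rw [← hf hn, Submodule.Quotient.mk_eq_zero]
      exact Submodule.smul_mem_pointwise_smul _ _ _ trivial
    · have hx : QuotSMulTop.map r (LinearMap.lsmul R N x) = LinearMap.lsmul R _ x := by
        ext
        rfl
      exact hx ▸ QuotSMulTop.map_exact r hex hdiv
    · intro n
      obtain ⟨n, rfl⟩ := Submodule.Quotient.mk_surjective _ n
      obtain ⟨n', rfl⟩ := hdiv n
      exact ⟨Submodule.Quotient.mk n', rfl⟩
    · intro n
      obtain ⟨n, rfl⟩ := Submodule.Quotient.mk_surjective _ n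
      obtain ⟨k, hk⟩ := htors n
      exact ⟨k, by rw [← Submodule.Quotient.mk_smul, hk, Submodule.Quotient.mk_zero]⟩

variable (M : Type u) [AddCommGroup M] [Module R M] (x : R)

/-- The cokernel of the localization map `M → M_x`, that is, the first local cohomology of `M`
with respect to `x`. -/
abbrev AwayQuotient : Type _ :=
  LocalizedModule (Submonoid.powers x) M ⧸
    LinearMap.range (LocalizedModule.mkLinearMap (Submonoid.powers x) M)

variable {M x}

lemma LocalizedModule.mkLinearMap_powers_injective (h : IsSMulRegular M x) :
    Function.Injective (LocalizedModule.mkLinearMap (Submonoid.powers x) M) := by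
  rw [← LinearMap.ker_eq_bot, LinearMap.ker_eq_bot']
  intro m hm
  obtain ⟨⟨_, k, rfl⟩, hc⟩ :=
    (IsLocalizedModule.eq_zero_iff (Submonoid.powers x) _).1 hm
  exact isSMulRegular_iff_right_eq_zero_of_smul.1 (h.pow k) m hc

lemma AwayQuotient.smul_surjective (n : AwayQuotient M x) : ∃ n', x • n' = n := by
  obtain ⟨n, rfl⟩ := Submodule.Quotient.mk_surjective _ n
  obtain ⟨n', rfl⟩ := ((Module.End.isUnit_iff _).1 (IsLocalizedModule.map_units
    (LocalizedModule.mkLinearMap (Submonoid.powers x) M) ⟨x, Submonoid.mem_powers x⟩)).2 n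
  exact ⟨Submodule.Quotient.mk n', rfl⟩

lemma AwayQuotient.pow_smul_eq_zero (n : AwayQuotient M x) : ∃ k : ℕ, x ^ k • n = 0 := by
  obtain ⟨n, rfl⟩ := Submodule.Quotient.mk_surjective _ n
  obtain ⟨⟨m, ⟨_, k, rfl⟩⟩, hm⟩ := IsLocalizedModule.surj (Submonoid.powers x)
    (LocalizedModule.mkLinearMap (Submonoid.powers x) M) n
  refine ⟨k, ?_⟩
  rw [← Submodule.Quotient.mk_smul, Submodule.Quotient.mk_eq_zero]
  exact ⟨m, hm.symm⟩

/-- If `x, rs` is weakly regular on `M`, then `rs` is weakly regular on `M_x / M`. -/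
lemma AwayQuotient.isWeaklyRegular {rs : List R} (h : IsWeaklyRegular M (x :: rs)) :
    IsWeaklyRegular (AwayQuotient M x) rs := by
  rw [isWeaklyRegular_cons_iff] at h
  set j := LocalizedModule.mkLinearMap (Submonoid.powers x) M
  have hj : Function.Injective j := LocalizedModule.mkLinearMap_powers_injective h.1
  have hu := (Module.End.isUnit_iff _).1 (IsLocalizedModule.map_units j
    (⟨x, Submonoid.mem_powers x⟩ : Submonoid.powers x))
  let e := LinearEquiv.ofBijective _ hu
  have he : ∀ y, x • e.symm y = y := e.apply_symm_apply
  -- The map `m ↦ [m / x]` identifies `M / xM` with the kernel of `x` on `M_x / M`.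
  let g : M →ₗ[R] AwayQuotient M x := Submodule.mkQ _ ∘ₗ e.symm.toLinearMap ∘ₗ j
  have hg : ∀ m, g m = 0 ↔ m ∈ (x • ⊤ : Submodule R M) := by
    intro m
    rw [Submodule.mem_smul_pointwise_iff_exists]
    refine (Submodule.Quotient.mk_eq_zero _).trans ⟨?_, ?_⟩
    · rintro ⟨m', hm'⟩
      refine ⟨m', trivial, hj ?_⟩
      rw [map_smul]
      exact (congrArg (x • ·) hm').trans (he _)
    · rintro ⟨m', -, rfl⟩
      exact ⟨m', (e.symm_apply_eq.2 (map_smul j x m')).symm⟩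
  refine isWeaklyRegular_of_ker_smul (x := x) rs
    (Submodule.liftQ (x • ⊤ : Submodule R M) g fun m hm => (hg m).2 hm) ?_ ?_
    AwayQuotient.smul_surjective AwayQuotient.pow_smul_eq_zero h.2
  · rw [← LinearMap.ker_eq_bot, LinearMap.ker_eq_bot']
    intro a ha
    obtain ⟨m, rfl⟩ := Submodule.Quotient.mk_surjective _ a
    exact (Submodule.Quotient.mk_eq_zero _).2 ((hg m).1 ha)
  · intro n
    obtain ⟨n, rfl⟩ := Submodule.Quotient.mk_surjective _ n
    refine (Submodule.Quotient.mk_eq_zero _).trans ⟨?_, ?_⟩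
    · rintro ⟨m, hm⟩
      refine ⟨Submodule.Quotient.mk m, congrArg Submodule.Quotient.mk ?_⟩
      exact e.symm_apply_eq.2 hm
    · rintro ⟨a, ha⟩
      obtain ⟨m, rfl⟩ := Submodule.Quotient.mk_surjective _ a
      obtain ⟨m', hm'⟩ := (Submodule.Quotient.eq _).1 ha
      refine ⟨m - x • m', ?_⟩
      rw [map_sub, map_smul]
      erw [hm']
      rw [smul_sub]
      erw [he]
      abel

end Regular

/-! ### Vanishing and nonvanishing of Tor. -/

section Tor

open MonoidalCategory

variable {R : Type u} [CommRing R]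

/-- On `X ⊗ Pⱼ`, with `P` a projective resolution of `Y`, the scalar `x` passes across the tensor
sign. -/
lemma tor_map_smul_app (X Y : ModuleCat.{u} R) (x : R) (i : ℕ) :
    ((Tor (ModuleCat.{u} R) i).map (x • 𝟙 X)).app Y =
      ((Tor (ModuleCat.{u} R) i).obj X).map (x • 𝟙 Y) := by
  let P := projectiveResolution Y
  change (NatTrans.leftDerived ((tensoringLeft (ModuleCat.{u} R)).map (x • 𝟙 X)) i).app Y =
    (((tensoringLeft (ModuleCat.{u} R)).obj X).leftDerived i).map (x • 𝟙 Y)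
  rw [ProjectiveResolution.leftDerived_app_eq _ P,
    Functor.leftDerived_map_eq _ i (x • 𝟙 Y) (P := P) (Q := P) (x • 𝟙 P.complex)]
  · congr 3
    ext j : 1
    change (x • 𝟙 X) ▷ P.complex.X j = X ◁ (x • 𝟙 (P.complex.X j))
    rw [MonoidalLinear.smul_whiskerRight, MonoidalLinear.whiskerLeft_smul]
    simp
  · ext j
    simp
    rfl

/-- `Tor i (X, Y)` vanishes if `x` acts invertibly on `X` and as zero on `Y`. -/
lemma isZero_tor_of_smul (X Y : ModuleCat.{u} R) (x : R) (hX : IsIso (x • 𝟙 X))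
    (hY : x • 𝟙 Y = 0) (i : ℕ) : Limits.IsZero (((Tor (ModuleCat.{u} R) i).obj X).obj Y) := by
  have h := tor_map_smul_app X Y x i
  have h0 : ((Tor (ModuleCat.{u} R) i).obj X).map (x • 𝟙 Y) = 0 := by
    rw [hY]
    refine (Functor.leftDerived_map_eq _ i 0 (P := projectiveResolution Y)
      (Q := projectiveResolution Y) 0 (by simp)).trans ?_
    rw [Functor.map_zero, Limits.zero_comp, Limits.comp_zero]
    rfl
  have : IsIso (((Tor (ModuleCat.{u} R) i).map (x • 𝟙 X)).app Y) := inferInstance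
  rw [h, h0] at this
  exact ((Limits.isIsoZero_iff_source_target_isZero _ _).1 this).1

lemma suppInv_primesNotContaining_of_bijective {I : Ideal R} {x : R} (hx : x ∈ I)
    (X : ModuleCat.{u} R) (h : Function.Bijective fun m : X => x • m) :
    suppInv (primesNotContaining I) X := by
  rintro p ⟨i, hi⟩ hI
  refine hi (isZero_tor_of_smul _ _ x ?_ ?_ i)
  · rw [ConcreteCategory.isIso_iff_bijective]
    exact h
  · ext a
    change x • a = 0
    rw [Algebra.smul_def, Ideal.algebraMap_residueField_eq_zero.2 (hI hx), zero_mul]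

/-- Degree `0` suffices: `Tor 0` is the tensor product, and `M ⊗ κ(p) ≠ 0` by Nakayama. -/
lemma mem_smallSupport_of_mem_support (M : Type u) [AddCommGroup M] [Module R M]
    [Module.Finite R M] {p : PrimeSpectrum R} (hp : p ∈ Module.support R M) :
    p ∈ smallSupport (ModuleCat.of R M) := by
  refine ⟨0, fun h => ?_⟩
  rw [Module.mem_support_iff_nontrivial_residueField_tensorProduct] at hp
  let κ := ModuleCat.of R p.asIdeal.ResidueField
  have : Limits.PreservesFiniteColimits ((tensoringLeft (ModuleCat.{u} R)).obj (.of R M)) :=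
    inferInstanceAs (Limits.PreservesFiniteColimits (tensorLeft (ModuleCat.of R M)))
  have e := ((tensoringLeft (ModuleCat.{u} R)).obj (.of R M)).leftDerivedZeroIsoSelf.app κ
  have hz : Limits.IsZero (ModuleCat.of R M ⊗ κ) := h.of_iso e.symm
  have hs := ModuleCat.subsingleton_of_isZero hz
  exact not_subsingleton _
    ((TensorProduct.comm R p.asIdeal.ResidueField M).toEquiv.subsingleton_congr.2 hs)

end Tor

open RingTheory.Sequence

/-- A weakly regular sequence `x₀, …, xₙ` in `I` on `M` yields an exact sequence
`0 ⟶ M ⟶ X⁰ ⟶ ⋯ ⟶ Xⁿ ⟶ N ⟶ 0` such that some element of `I` acts invertibly on each `Xⁱ`. -/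
lemma exists_isExactFromZeroToZero {R : Type u} [CommRing R] {I : Ideal R} (n : ℕ) :
    ∀ (M : Type u) [AddCommGroup M] [Module R M] (rs : List R), rs.length = n + 1 →
      (∀ r ∈ rs, r ∈ I) → IsWeaklyRegular M rs →
      ∃ F : ComposableArrows (ModuleCat.{u} R) (n + 2), IsExactFromZeroToZero F ∧
        F.obj' 0 = ModuleCat.of R M ∧
        ∀ (i : ℕ) (_ : i ≤ n), suppInv (primesNotContaining I) (F.obj' (i + 1)) := by
  have key : ∀ (M : Type u) [AddCommGroup M] [Module R M] (x : R), x ∈ I → IsSMulRegular M x →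
      ∃ (B : ModuleCat.{u} R) (f : ModuleCat.of R M ⟶ B)
        (g : B ⟶ ModuleCat.of R (AwayQuotient M x)) (w : f ≫ g = 0),
        (ShortComplex.mk f g w).ShortExact ∧ suppInv (primesNotContaining I) B := by
    intro M _ _ x hx hr
    refine ⟨ModuleCat.of R (LocalizedModule (Submonoid.powers x) M),
      ModuleCat.ofHom (LocalizedModule.mkLinearMap _ M), ModuleCat.ofHom (Submodule.mkQ _),
      ?_, ?_, ?_⟩
    · ext m
      exact (Submodule.Quotient.mk_eq_zero _).2 ⟨m, rfl⟩
    · exact { exact := (ShortComplex.ShortExact.moduleCat_exact_iff_function_exact _).2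
                  (LinearMap.exact_map_mkQ_range _)
              mono_f := (ModuleCat.mono_iff_injective _).2
                  (LocalizedModule.mkLinearMap_powers_injective hr)
              epi_g := (ModuleCat.epi_iff_surjective _).2 (Submodule.mkQ_surjective _) }
    · exact suppInv_primesNotContaining_of_bijective hx _ ((Module.End.isUnit_iff _).1
        (IsLocalizedModule.map_units (LocalizedModule.mkLinearMap (Submonoid.powers x) M)
          ⟨x, Submonoid.mem_powers x⟩))
  induction n with
  | zero =>
    intro M _ _ rs hlen hI hreg
    obtain ⟨x, rfl⟩ := List.length_eq_one_iff.1 hlen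
    obtain ⟨B, f, g, w, hS, hB⟩ := key M x (hI x (by simp))
      ((isWeaklyRegular_cons_iff _ _ _).1 hreg).1
    refine ⟨_, .mk₂ f g w hS, rfl, fun i hi => ?_⟩
    obtain rfl : i = 0 := by omega
    exact hB
  | succ n ih =>
    intro M _ _ rs hlen hI hreg
    obtain ⟨x, rs, rfl⟩ := List.exists_cons_of_length_eq_add_one hlen
    obtain ⟨F, hF, h0, hX⟩ := ih (AwayQuotient M x) rs (by simpa using hlen)
      (fun r hr => hI r (by simp [hr])) (AwayQuotient.isWeaklyRegular hreg)
    have hkey := key M x (hI x (by simp)) ((isWeaklyRegular_cons_iff _ _ _).1 hreg).1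
    rw [← h0] at hkey
    obtain ⟨B, f, g, w, hS, hB⟩ := hkey
    refine ⟨_, hF.splice f g w hS, rfl, fun i hi => ?_⟩
    cases i with
    | zero => exact hB
    | succ i => exact hX i (by omega)

end NWide

theorem mainTheorem7 {R : Type u} [CommRing R] [IsNoetherianRing R] (I : Ideal R) (n : ℕ)
    (M : Type u) [AddCommGroup M] [Module R M] [Module.Finite R M]
    (hIM : I • (⊤ : Submodule R M) ≠ ⊤)
    (hwide : NWide.IsNWide (NWide.suppInv (NWide.primesNotContaining I)) n) :
    NWide.idealGrade I M ≤ (n : ℕ∞) := by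
  refine iSup_le ?_
  rintro ⟨rs, hI, hreg⟩
  by_contra! hlt
  have hlen : n + 1 ≤ rs.length := by exact_mod_cast hlt
  -- Exactly `n + 1` elements are kept, one for each of `X⁰, …, Xⁿ`.
  have htake : RingTheory.Sequence.IsWeaklyRegular M (rs.take (n + 1)) := by
    have h := hreg.toIsWeaklyRegular
    rw [← List.take_append_drop (n + 1) rs,
      RingTheory.Sequence.isWeaklyRegular_append_iff] at h
    exact h.1
  obtain ⟨F, hF, h0, hX⟩ := NWide.exists_isExactFromZeroToZero (I := I) n M (rs.take (n + 1))
    (by simpa using hlen) (fun r hr => hI r (List.mem_of_mem_take hr)) htake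
  have hM := hwide.kernels F hF hX
  rw [h0] at hM
  have : Nontrivial (M ⧸ I • (⊤ : Submodule R M)) := Submodule.Quotient.nontrivial_iff.2 hIM
  obtain ⟨p, hp⟩ := Module.nonempty_support_of_nontrivial (R := R)
    (M := M ⧸ I • (⊤ : Submodule R M))
  rw [Module.support_quotient] at hp
  exact hM (NWide.mem_smallSupport_of_mem_support M hp.1) hp.2
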